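/- **Setting.** For a next-token generator $f:\{0,1\}^*\to\{0,1\}$ let $\bar f(x)$ be the string $x$ with the bit $f(x)$ appended, and for $T\ge 1$ let $f^{\mathsf{e2e}\text{-}T}(x)$ be the last bit of $\bar f\circ\cdots\circ\bar f(x)$ ($T$ times). For a class $\mathcal F$ of generators, $\mathcal F^{\mathsf{e2e}\text{-}T}=\{f^{\mathsf{e2e}\text{-}T}: f\in\mathcal F\}$. For $d\ge1$ let $\mathcal F_{d,\mathrm{lin}}$ be the class of generators $$f_{w,b}(x)=\mathbf 1\Big[\sum_{i=1}^{\min(d,|x|)} w[-i]\,x[-i]+b\ge 0\Big],\qquad w\in\mathbb R^d,\ b\in\mathbb R,$$ where negative indices count from the end. A *threshold circuit* over $n\geq 1$ binary inputs is a finite connected directed acyclic graph with real edge weights, with $n$ input nodes (the only nodes without incoming edges) and one output node (the only node without outgoing edges); an input node has as value the corresponding input bit, any other node $v$ has the value $\mathbf 1[\sum_{(u,v)\in E} w(u,v)\,\mathrm{val}(u)\ge 0]$, and the circuit computes the value of the output node. Its size is the number of non-input nodes, its depth the length of the longest path from an input node to the output node. Let $(\mathcal H_a)$ be a family of classes, indexed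 by vectors $a$ of positive integers, with $\mathcal H_a$ consisting of functions $\{0,1\}^n\to\{0,1\}$, where $n$ is one of the entries of $a$. The family is *learnable to accuracy $\varepsilon$ and confidence $\delta$ in time polynomial in $a$* if there are a single algorithm $A$, which is given $a$, and sample sizes $m(a)$ bounded by a polynomial in $a$, such that for all $a$, every target $f\in\mathcal H_a$ and every distribution $D$ on $\{0,1\}^n$: given $m(a)$ independent examples $(x_i,f(x_i))$, $x_i\sim D$, $A$ halts within a number of steps polynomial in $a$ and outputs the representation of a hypothesis $h:\{0,1\}^n\to\{0,1\}$, not necessarily in $\mathcal H_a$, which can be evaluated at any point in time polynomial in $a$ (by one algorithm, given $a$, the representation and the point), and with probability at least $1-\delta$, $\Pr_{x\sim D}(h(x)\neq f(x))\le\varepsilon$. For $\mathcal F^{\mathsf{e2e}\text{-}T}_{d,\mathrm{lin}}$ restricted to $\{0,1\}^n$ with $a=(n,d,T)$ this is called $\mathsf{e2e}$-learnability in time $\mathrm{Poly}(d,T,n)$. **Theorem.** Assume that there exist a constant $L>0$ and a polynomial $p$ such that threshold circuits of depth at most $L$ and size at most $p(n)$ over $n$ binary inputs are not weakly PAC-learnable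 in time $\mathrm{Poly}(n)$: for no constants $0<\varepsilon<1/2$ and $0<\delta<1$ are they learnable to accuracy $\varepsilon$ and confidence $\delta$ in time polynomial in $n$. Then for no constants $0<\varepsilon<1/2$ and $0<\delta<1$ is there an algorithm (even improper) that $\mathsf{e2e}$-learns $\mathcal F_{d,\mathrm{lin}}^{\mathsf{e2e}\text{-}T}$ over $\{0,1\}^n$ to accuracy $\varepsilon$ and confidence $\delta$ in time $\mathrm{Poly}(d,T,n)$. This holds when "algorithm" means deterministic algorithm, in assumption and conclusion, and also when it means algorithm that may use polynomially many random bits, in assumption and conclusion. -/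

import Mathlib

open MeasureTheory

/-! ### Autoregressive generation and iterated linear thresholds -/

/-- The numerical value `0` or `1` of a bit. -/
def bit (b : Bool) : ℝ := if b then 1 else 0

open Classical in
/-- The threshold function: `thr z = 1` if `z ≥ 0`, and `thr z = 0` otherwise. -/
noncomputable def thr (z : ℝ) : Bool := decide (0 ≤ z)

/-- Apply a next-token generator `f` to a string and append the generated token. -/
def applyAppend (f : List Bool → Bool) (x : List Bool) : List Bool := x ++ [f x]

/-- The `T`-step Chain-of-Thought of `f` on `x` (a string of length `|x| + T`). -/
def chainOfThought (f : List Bool → Bool) (T : ℕ) (x : List Bool) : List Bool :=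
  (applyAppend f)^[T] x

/-- The end-to-end map: the last token of the `T`-step Chain-of-Thought. (For `T ≥ 1` the
Chain-of-Thought is not empty, so the default value is not used.) -/
def endToEnd (f : List Bool → Bool) (T : ℕ) (x : List Bool) : Bool :=
  (chainOfThought f T x).getLastD false

/-- The generator `x ↦ 1[∑_{i = 1}^{min d |x|} w[-i] x[-i] + b ≥ 0]`, where negative indices count
from the end. In the sum below `j = i - 1`; positions beyond the start of `x` contribute `0`. -/
noncomputable def linGen {d : ℕ} (w : Fin d → ℝ) (b : ℝ) (x : List Bool) : Bool :=
  thr (∑ j : Fin d, w j.rev * bit (x.reverse.getD j false) + b)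

/-- The base class of `d`-dimensional linear thresholds, as next-token generators. -/
def linClass (d : ℕ) : Set (List Bool → Bool) :=
  {f | ∃ (w : Fin d → ℝ) (b : ℝ), f = linGen w b}

/-- The end-to-end class of `T`-step iterations of generators in `F`, over the domain `{0,1}^n`. -/
def endToEndClass (F : Set (List Bool → Bool)) (T n : ℕ) : Set ((Fin n → Bool) → Bool) :=
  {h | ∃ f ∈ F, ∀ x, h x = endToEnd f T (List.ofFn x)}

/-! ### Linear threshold circuits -/

/-- A linear threshold circuit with `n` input nodes `Sum.inl i` and `s` further nodes (gates)
`Sum.inr g`: a directed acyclic graph in which the input nodes are precisely the nodes without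
incoming edges, and the output node is the only node without outgoing edges (as every node then has
a path to the output node, the graph is connected). Only the weights of edges matter. -/
structure ThresholdCircuit (n s : ℕ) where
  /-- there is an edge from the first node to the second one -/
  edge : Fin n ⊕ Fin s → Fin n ⊕ Fin s → Prop
  /-- the weight of the edge from the first node to the second one -/
  weight : Fin n ⊕ Fin s → Fin n ⊕ Fin s → ℝ
  /-- the output node -/
  out : Fin s
  acyclic : ∀ v, ¬ Relation.TransGen edge v v
  no_incoming_iff : ∀ v, (∀ u, ¬ edge u v) ↔ ∃ i, v = Sum.inl i
  no_outgoing_iff : ∀ v, (∀ u, ¬ edge v u) ↔ v = Sum.inr out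

namespace ThresholdCircuit

variable {n s : ℕ} (C : ThresholdCircuit n s)

theorem wellFounded_edge : WellFounded C.edge := by
  have : Std.Irrefl (Relation.TransGen C.edge) := ⟨C.acyclic⟩
  have h : WellFounded (Relation.TransGen C.edge) :=
    Finite.wellFounded_of_trans_of_irrefl _
  exact Subrelation.wf (fun {_ _} hab => Relation.TransGen.single hab) h

open Classical in
/-- The value of a node on input `x`: the input bit at an input node, and the threshold of the
weighted sum of the values of the predecessors at a gate. -/
noncomputable def val (x : Fin n → Bool) : Fin n ⊕ Fin s → Bool :=
  C.wellFounded_edge.fix fun v rec =>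
    match v, rec with
    | Sum.inl i, _ => x i
    | Sum.inr g, rec =>
        thr (∑ u, if h : C.edge u (Sum.inr g) then C.weight u (Sum.inr g) * bit (rec u h) else 0)

theorem val_inl (x : Fin n → Bool) (i : Fin n) : C.val x (Sum.inl i) = x i := by
  rw [val, WellFounded.fix_eq]

open Classical in
theorem val_inr (x : Fin n → Bool) (g : Fin s) :
    C.val x (Sum.inr g) =
      thr (∑ u, if C.edge u (Sum.inr g) then
        C.weight u (Sum.inr g) * bit (C.val x u) else 0) := by
  rw [val, WellFounded.fix_eq]
  simp only [dite_eq_ite]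

/-- The Boolean function computed by the circuit. -/
noncomputable def eval (x : Fin n → Bool) : Bool := C.val x (Sum.inr C.out)

/-- The depth is at most `L`: every path from an input node to the output node has at most `L`
edges. -/
def DepthLE (L : ℕ) : Prop :=
  ∀ (k : ℕ) (path : Fin (k + 1) → Fin n ⊕ Fin s),
    (∀ i : Fin k, C.edge (path i.castSucc) (path i.succ)) →
    (∃ i, path 0 = Sum.inl i) → path (Fin.last k) = Sum.inr C.out → k ≤ L

end ThresholdCircuit

/-- Functions on `{0,1}^n` computed by threshold circuits of size at most `s` and depth at most
`L`. The size of a circuit is its number of non-input nodes. -/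
def circuitClass (n s L : ℕ) : Set ((Fin n → Bool) → Bool) :=
  {h | ∃ s' ≤ s, ∃ C : ThresholdCircuit n s', C.DepthLE L ∧ ∀ x, h x = C.eval x}

/-! ### Programs with a step count

The machine model: structured programs acting on bit stacks (registers `0, 1, 2, …`, of which each
program mentions only finitely many), with unit cost for each push, pop and test. These are the
multi-stack, equivalently the multi-tape Turing machines, up to constant factors in the running
time. -/

/-- Programs. -/
inductive Prog : Type
  /-- do nothing -/
  | skip : Prog
  /-- push the bit `b` onto stack `r` -/
  | push (r : ℕ) (b : Bool) : Prog
  /-- remove the top of stack `r`, if there is one -/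
  | pop (r : ℕ) : Prog
  /-- run one program after the other -/
  | seq (P Q : Prog) : Prog
  /-- continue with `P`, `Q`, `R` if stack `r` is empty, has top `0`, has top `1`, respectively -/
  | branch (r : ℕ) (P Q R : Prog) : Prog
  /-- repeat `P` as long as stack `r` is not empty -/
  | loop (r : ℕ) (P : Prog) : Prog

/-- The contents of all stacks; the head of a list is the top of the stack. -/
abbrev Store : Type := ℕ → List Bool

/-- `Exec P σ t τ`: started with stack contents `σ`, the program `P` halts after exactly `t` steps,
with stack contents `τ`. -/
inductive Exec : Prog → Store → ℕ → Store → Prop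
  | skip (σ : Store) : Exec Prog.skip σ 1 σ
  | push (r : ℕ) (b : Bool) (σ : Store) :
      Exec (Prog.push r b) σ 1 (Function.update σ r (b :: σ r))
  | pop (r : ℕ) (σ : Store) : Exec (Prog.pop r) σ 1 (Function.update σ r (σ r).tail)
  | seq {P Q : Prog} {σ τ υ : Store} {t u : ℕ} (hP : Exec P σ t τ) (hQ : Exec Q τ u υ) :
      Exec (Prog.seq P Q) σ (t + u) υ
  | branch_nil {r : ℕ} {P Q R : Prog} {σ τ : Store} {t : ℕ} (h : σ r = [])
      (hP : Exec P σ t τ) : Exec (Prog.branch r P Q R) σ (t + 1) τ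
  | branch_zero {r : ℕ} {P Q R : Prog} {σ τ : Store} {t : ℕ} (h : (σ r).head? = some false)
      (hQ : Exec Q σ t τ) : Exec (Prog.branch r P Q R) σ (t + 1) τ
  | branch_one {r : ℕ} {P Q R : Prog} {σ τ : Store} {t : ℕ} (h : (σ r).head? = some true)
      (hR : Exec R σ t τ) : Exec (Prog.branch r P Q R) σ (t + 1) τ
  | loop_stop {r : ℕ} {P : Prog} {σ : Store} (h : σ r = []) : Exec (Prog.loop r P) σ 1 σ
  | loop_step {r : ℕ} {P : Prog} {σ τ υ : Store} {t u : ℕ} (h : σ r ≠ [])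
      (hP : Exec P σ t τ) (hL : Exec (Prog.loop r P) τ u υ) :
      Exec (Prog.loop r P) σ (t + u + 1) υ

/-- With the strings of the list `inp` on stacks `0, 1, 2, …` and all other stacks empty, `P` halts
within `t` steps, with the string `out` on stack `0`. -/
def Prog.Outputs (P : Prog) (inp : List (List Bool)) (t : ℕ) (out : List Bool) : Prop :=
  ∃ t' ≤ t, ∃ τ : Store, Exec P (fun r => inp.getD r []) t' τ ∧ τ 0 = out

/-! ### PAC learning in polynomial time -/

/-- The training sample `(x₁, f x₁), …, (x_m, f x_m)`, written as one bit string. -/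
def sampleBits {n m : ℕ} (f : (Fin n → Bool) → Bool) (xs : Fin m → Fin n → Bool) : List Bool :=
  (List.ofFn fun j => List.ofFn (xs j) ++ [f (xs j)]).flatten

/-- The parameters, written in unary. -/
def paramBits {k : ℕ} (a : Fin k → ℕ) : List (List Bool) :=
  List.ofFn fun i => List.replicate (a i) true

/-- A learning algorithm. `train` maps the parameters, a sample and a string of random bits to a
string, the representation of a hypothesis; `predict` evaluates a represented hypothesis at a
point. -/
structure Learner where
  train : Prog
  predict : Prog

/-- Given the parameters `a`, the sample `S` and the random bits `c`, the learner outputs within `t`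
steps a representation of the hypothesis `h`, and `h` can be evaluated from that representation
within `t` steps at any point. The hypothesis is not restricted in any other way. -/
def Learner.Returns (A : Learner) {k : ℕ} (a : Fin (k + 1) → ℕ) (t : ℕ) (S c : List Bool)
    (h : (Fin (a 0) → Bool) → Bool) : Prop :=
  ∃ rep : List Bool, A.train.Outputs (paramBits a ++ [S, c]) t rep ∧
    ∀ x, A.predict.Outputs (paramBits a ++ [rep, List.ofFn x]) t [h x]

/-- The uniform distribution on strings of `r` bits. -/
noncomputable def coinFlips (r : ℕ) : Measure (Fin r → Bool) :=
  (PMF.uniformOfFintype (Fin r → Bool)).toMeasure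

/-- Consider a family of classes `H a` of Boolean functions on `{0,1}^n`, where `a` is a vector of
positive integers whose entry `a 0` is `n`. There is a single algorithm, which is given `a`, that
learns (possibly improperly) each class `H a` in the realizable setting to accuracy `ε` and
confidence `δ`, with sample size and running time bounded by a polynomial in the entries of `a`.
If `randomized` is false, the algorithm is deterministic (it gets no random bits); otherwise it may
use polynomially many random bits. -/
def PolyTimeLearnable (randomized : Bool) {k : ℕ}
    (H : (a : Fin (k + 1) → ℕ) → Set ((Fin (a 0) → Bool) → Bool)) (ε δ : ℝ) : Prop :=
  ∃ (A : Learner) (time coins : MvPolynomial (Fin (k + 1)) ℕ) (m : (Fin (k + 1) → ℕ) → ℕ),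
    (randomized = false → coins = 0) ∧
    ∀ a : Fin (k + 1) → ℕ, (∀ i, 0 < a i) →
      m a ≤ MvPolynomial.eval a time ∧
      ∀ f ∈ H a,
        (∀ (xs : Fin (m a) → Fin (a 0) → Bool) (c : Fin (MvPolynomial.eval a coins) → Bool),
          ∃ h, A.Returns a (MvPolynomial.eval a time) (sampleBits f xs) (List.ofFn c) h) ∧
        ∀ D : Measure (Fin (a 0) → Bool), IsProbabilityMeasure D →
          1 - δ ≤ ((Measure.pi fun _ : Fin (m a) => D).prod
              (coinFlips (MvPolynomial.eval a coins))).real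
            {ω | ∃ h, A.Returns a (MvPolynomial.eval a time) (sampleBits f ω.1) (List.ofFn ω.2) h ∧
              D.real {x | h x ≠ f x} ≤ ε}

/-- Hardness of learning constant-depth threshold circuits: for some depth `L` and some polynomial
size bound `p`, threshold circuits of depth `L` and size `p n` over `n` inputs are not weakly
PAC-learnable in time polynomial in `n`, to whatever constants `ε < 1/2` and `δ < 1`. -/
def HardnessOfLearningTC0 (randomized : Bool) : Prop :=
  ∃ (L : ℕ) (p : Polynomial ℕ), 0 < L ∧
    ∀ ε δ : ℝ, 0 < ε → ε < 1 / 2 → 0 < δ → δ < 1 →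
      ¬ PolyTimeLearnable randomized
          (fun a : Fin 1 → ℕ => circuitClass (a 0) (p.eval (a 0)) L) ε δ

/-- Iterated linear thresholds over `{0,1}^n` are end-to-end learnable to accuracy `ε` and
confidence `δ` in time polynomial in `n`, `d` and `T`; the parameter vector is `(n, d, T)`. -/
def PolyTimeEndToEndLearnableLin (randomized : Bool) (ε δ : ℝ) : Prop :=
  PolyTimeLearnable randomized
    (fun a : Fin 3 → ℕ => endToEndClass (linClass (a 1)) (a 2) (a 0)) ε δ

/-! ### Simulating a circuit by an iterated linear threshold -/

/-! A single iterated linear threshold can run any circuit of polynomial size on a padded input, so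
an end-to-end learner that is fed padded examples learns circuits.

The obstacle is that the generator uses the same weights, indexed by the distance to the new token,
at every step, whereas each gate needs its own. So the nodes are placed in the string in such a way
that the distance from a node to a gate identifies the pair: inputs are consecutive, gates sit at `e
+ sidon A (gateRank g)`, and ranks increase along edges. The weight at a distance is that of the
unique edge realising it, or 0 if there is none. Positions without a gate have to produce 0. Here
the leading 1 of the padded input serves as a clock: at position `t` it is seen with weight `W t`, a
bias depending on `t`, which is 0 at gates and very negative elsewhere. The zeros of the padding
make distances to this marker larger than all distances from gates to nodes, so the two roles of `W`
do not collide. This is `exists_weights`; `exists_linGen` provides the positions, with the output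
gate at the last generated token. The Sidon sequence grows quadratically for fixed `A`, so all
parameters stay polynomial in `n`.

For the learning part, let `φ` be the padding and `f = g ∘ φ`. Padded examples from `D` are examples
from `D.map φ`, and the error of `h` under `D.map φ` is the error of `h ∘ φ` under `D`. The random
bits are passed on unchanged, which covers deterministic and randomized learners alike.
`runs_padTrain` and `runs_padPredict` show that explicit programs do the padding in polynomial time,
and `PolyTimeLearnable.of_endToEnd` assembles the reduction. -/

lemma linGen_map_range {d t : ℕ} (htd : t ≤ d) (W : ℕ → ℝ) (z : ℕ → Bool) :
    linGen (fun i : Fin d => W (d - i)) 0 ((List.range t).map z) =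
      thr (∑ q ∈ Finset.range t, W (t - q) * bit (z q)) := by
  unfold linGen
  congr 1
  rw [add_zero]
  -- The token at distance `j + 1` from the new position meets the weight `W (j + 1)`, whatever `d`
  -- is. For `j ≥ t` the default token contributes 0.
  have h1 : ∀ j : Fin d, W (d - (j.rev : Fin d)) *
      bit (((List.range t).map z).reverse.getD j false) =
      if (j : ℕ) < t then W (j + 1) * bit (z (t - 1 - j)) else 0 := by
    intro j
    have hj : d - ((j.rev : Fin d) : ℕ) = j + 1 := by
      rw [Fin.val_rev]; omega
    rw [hj]
    by_cases h : (j : ℕ) < t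
    · rw [if_pos h, List.getD_eq_getElem _ _ (by simpa using h)]
      simp
    · rw [if_neg h, List.getD_eq_default _ _ (by simpa using h)]
      simp [bit]
  rw [Finset.sum_congr rfl fun j _ => h1 j,
    Fin.sum_univ_eq_sum_range (fun j => if j < t then W (j + 1) * bit (z (t - 1 - j)) else 0) d,
    ← Finset.sum_filter]
  have h2 : (Finset.range d).filter (· < t) = Finset.range t := by
    ext j; simp; omega
  rw [h2, ← Finset.sum_range_reflect (fun q => W (t - q) * bit (z q)) t]
  refine Finset.sum_congr rfl fun j hj => ?_
  have : t - (t - 1 - j) = j + 1 := by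
    have := Finset.mem_range.1 hj
    omega
  rw [this]

/-- As `N + T ≤ d`, the window of the generator always contains the whole string, marker included,
so each step is the recursion for `z`. -/
lemma chainOfThought_linGen {d N T : ℕ} (hd : N + T ≤ d) (W : ℕ → ℝ) (z : ℕ → Bool)
    (hz : ∀ t, N ≤ t → z t = thr (∑ q ∈ Finset.range t, W (t - q) * bit (z q))) :
    ∀ k ≤ T, chainOfThought (linGen (fun i : Fin d => W (d - i)) 0) k ((List.range N).map z) =
      (List.range (N + k)).map z := by
  intro k hk
  induction k with
  | zero => rfl
  | succ k ih =>
    unfold chainOfThought at ih ⊢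
    rw [Function.iterate_succ_apply', ih (by omega), applyAppend,
      linGen_map_range (by omega), ← hz _ (by omega), ← add_assoc, List.range_succ,
      List.map_append]
    rfl

lemma bit_nonneg (b : Bool) : 0 ≤ bit b := by unfold bit; split_ifs <;> norm_num

lemma bit_le_one (b : Bool) : bit b ≤ 1 := by unfold bit; split_ifs <;> norm_num

/-! ### Circuits laid out along a string -/

namespace ThresholdCircuit

variable {n s : ℕ} (C : ThresholdCircuit n s)

open Classical in
/-- The string in which position `0` holds a marker, position `pos v` holds the value of the node
`v`, and all other bits vanish. -/
noncomputable def layout (pos : Fin n ⊕ Fin s → ℕ) (x : Fin n → Bool) (t : ℕ) : Bool :=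
  decide (t = 0 ∨ ∃ v, pos v = t ∧ C.val x v = true)

lemma layout_pos {pos : Fin n ⊕ Fin s → ℕ} (hinj : Function.Injective pos) (h0 : ∀ v, 0 < pos v)
    (x : Fin n → Bool) (v : Fin n ⊕ Fin s) : C.layout pos x (pos v) = C.val x v := by
  unfold layout
  rw [Bool.eq_iff_iff, decide_eq_true_iff]
  constructor
  · rintro (h | ⟨u, hu, h⟩)
    · exact absurd h (h0 v).ne'
    · rwa [← hinj hu]
  · exact fun h => Or.inr ⟨v, rfl, h⟩

open Classical in
lemma bit_layout {pos : Fin n ⊕ Fin s → ℕ} (hinj : Function.Injective pos) (h0 : ∀ v, 0 < pos v)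
    (x : Fin n → Bool) (t : ℕ) : bit (C.layout pos x t) =
      (if t = 0 then 1 else 0) + ∑ v, if pos v = t then bit (C.val x v) else 0 := by
  by_cases ht : ∃ v, pos v = t
  · obtain ⟨v, rfl⟩ := ht
    rw [C.layout_pos hinj h0, if_neg (h0 v).ne', zero_add, Finset.sum_eq_single v]
    · simp
    · intro u _ hu
      exact if_neg fun h => hu (hinj h)
    · simp
  · rw [Finset.sum_eq_zero fun v _ => if_neg fun h => ht ⟨v, h⟩, add_zero]
    have : C.layout pos x t = decide (t = 0) := by
      unfold layout
      congr 1
      exact propext ⟨fun h => h.resolve_right fun ⟨v, hv, _⟩ => ht ⟨v, hv⟩, Or.inl⟩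
    rw [this, bit]
    simp

open Classical in
-- The marker at position 0 accounts for the term `W t`, a bias that may depend on the time `t`.
lemma sum_layout {pos : Fin n ⊕ Fin s → ℕ} (hinj : Function.Injective pos) (h0 : ∀ v, 0 < pos v)
    (x : Fin n → Bool) (W : ℕ → ℝ) {t : ℕ} (ht : 0 < t) :
    ∑ q ∈ Finset.range t, W (t - q) * bit (C.layout pos x q) =
      W t + ∑ v, if pos v < t then W (t - pos v) * bit (C.val x v) else 0 := by
  simp_rw [C.bit_layout hinj h0, mul_add, Finset.sum_add_distrib, Finset.mul_sum]
  congr 1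
  · rw [Finset.sum_eq_single 0]
    · simp
    · intro q _ hq
      simp [hq]
    · simp [ht.ne']
  · rw [Finset.sum_comm]
    refine Finset.sum_congr rfl fun v _ => ?_
    simp_rw [mul_ite, mul_zero, Finset.sum_ite_eq, Finset.mem_range]

open Classical in
/-- If the nodes of a circuit are placed so that differences of positions determine edges, then the
values at gates obey a translation-invariant linear threshold recursion. -/
theorem exists_weights {pos : Fin n ⊕ Fin s → ℕ} {N : ℕ} (hN : 0 < N)
    (hinj : Function.Injective pos) (h0 : ∀ v, 0 < pos v)
    (hinput : ∀ i, pos (Sum.inl i) < N)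
    (hoff : ∀ v g, pos (Sum.inr g) < N + pos v)
    (hedge : ∀ u g, C.edge u (Sum.inr g) → pos u < pos (Sum.inr g))
    (hsidon : ∀ u v g h, C.edge u (Sum.inr h) → pos v < pos (Sum.inr g) →
      pos u + pos (Sum.inr g) = pos (Sum.inr h) + pos v → u = v ∧ h = g) :
    ∃ W : ℕ → ℝ, ∀ x t, N ≤ t → C.layout pos x t =
      thr (∑ q ∈ Finset.range t, W (t - q) * bit (C.layout pos x q)) := by
  set B : ℝ := ∑ u, ∑ g, |C.weight u (Sum.inr g)| with hB
  have hB0 : 0 ≤ B := Finset.sum_nonneg fun _ _ => Finset.sum_nonneg fun _ _ => abs_nonneg _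
  -- All nodes together contribute at most `card * B`. The extra 1 makes the sum strictly negative,
  -- as `thr 0` is 1.
  set M : ℝ := Fintype.card (Fin n ⊕ Fin s) * B + 1 with hM
  have hM0 : 0 < M := by positivity
  -- Distances below `N` carry edge weights; distances from `N` on carry the bias supplied by the
  -- marker.
  let W : ℕ → ℝ := fun δ =>
    if δ < N then ∑ u, ∑ g, if C.edge u (Sum.inr g) ∧ pos u + δ = pos (Sum.inr g) then
      C.weight u (Sum.inr g) else 0
    else if ∃ g, pos (Sum.inr g) = δ then 0 else -M
  have hWB : ∀ δ, W δ ≤ B := by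
    intro δ
    simp only [W]
    split_ifs
    · refine Finset.sum_le_sum fun u _ => Finset.sum_le_sum fun g _ => ?_
      split_ifs
      · exact le_abs_self _
      · exact abs_nonneg _
    · exact hB0
    · linarith
  refine ⟨W, fun x t ht => ?_⟩
  rw [C.sum_layout hinj h0 x W (by omega)]
  by_cases hg : ∃ g, pos (Sum.inr g) = t
  · obtain ⟨g, rfl⟩ := hg
    rw [C.layout_pos hinj h0, C.val_inr]
    have hWt : W (pos (Sum.inr g)) = 0 := by
      simp only [W]
      rw [if_neg (by omega), if_pos ⟨g, rfl⟩]
    rw [hWt, zero_add]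
    congr 1
    refine Finset.sum_congr rfl fun v _ => ?_
    by_cases hv : pos v < pos (Sum.inr g)
    · rw [if_pos hv]
      -- By `hoff` this distance is below `N`, and by `hsidon` only the pair `(v, g)` can be an edge
      -- realising it, so at most one term of the double sum survives.
      have hWv : W (pos (Sum.inr g) - pos v) =
          if C.edge v (Sum.inr g) then C.weight v (Sum.inr g) else 0 := by
        simp only [W]
        rw [if_pos (by have := hoff v g; omega), Finset.sum_eq_single v, Finset.sum_eq_single g]
        · have : pos v + (pos (Sum.inr g) - pos v) = pos (Sum.inr g) := by omega
          simp [this]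
        · intro h _ hh
          refine if_neg fun ⟨h1, h2⟩ => hh (hsidon v v g h h1 hv (by omega)).2
        · simp
        · intro u _ hu
          refine Finset.sum_eq_zero fun h _ => if_neg fun ⟨h1, h2⟩ => hu ?_
          exact (hsidon u v g h h1 hv (by omega)).1
        · simp
      rw [hWv, ite_mul, zero_mul]
    · rw [if_neg hv, if_neg fun h => hv (hedge v g h)]
  · have hl : C.layout pos x t = false := by
      unfold layout
      rw [decide_eq_false_iff_not]
      rintro (h | ⟨v | g, hv, -⟩)
      · omega
      · have := hinput v
        omega
      · exact hg ⟨g, hv⟩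
    have hWt : W t = -M := by
      simp only [W]
      rw [if_neg (by omega), if_neg hg]
    rw [hl, eq_comm, thr, decide_eq_false_iff_not, not_le, hWt]
    -- Away from gates, distances to nodes are arbitrary and may reach `N`, but the upper bound
    -- `hWB` holds for all of them.
    have : (∑ v, if pos v < t then W (t - pos v) * bit (C.val x v) else 0) ≤
        ∑ _v : Fin n ⊕ Fin s, B := by
      refine Finset.sum_le_sum fun v _ => ?_
      split_ifs
      · have h1 := bit_nonneg (C.val x v)
        have h2 := bit_le_one (C.val x v)
        calc W (t - pos v) * bit (C.val x v) ≤ B * bit (C.val x v) :=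
              mul_le_mul_of_nonneg_right (hWB _) h1
          _ ≤ B * 1 := mul_le_mul_of_nonneg_left h2 hB0
          _ = B := mul_one B
      · exact hB0
    rw [Finset.sum_const, Finset.card_univ, nsmul_eq_mul] at this
    linarith

open Classical in
/-- An injective numbering of the gates that increases along edges: order by the number of
ancestors, break ties by the index. -/
noncomputable def gateRank (g : Fin s) : ℕ :=
  (Finset.univ.filter fun h : Fin s =>
    Relation.TransGen C.edge (Sum.inr h) (Sum.inr g)).card * s + g

lemma gateRank_injective : Function.Injective C.gateRank := by
  intro g h hgh
  unfold gateRank at hgh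
  have h1 := congrArg (· % s) hgh
  simp only [Nat.mul_add_mod_self_right, Nat.mod_eq_of_lt g.2, Nat.mod_eq_of_lt h.2] at h1
  exact Fin.ext h1

lemma gateRank_lt (g : Fin s) : C.gateRank g < s * s + s := by
  classical
  unfold gateRank
  have h1 : (Finset.univ.filter fun h : Fin s =>
      Relation.TransGen C.edge (Sum.inr h) (Sum.inr g)).card ≤ s :=
    (Finset.card_le_univ _).trans (Fintype.card_fin s).le
  have := Nat.mul_le_mul_right s h1
  have := g.2
  omega

/-- The ancestors of `g` are ancestors of `h`, and by acyclicity `g` is an additional one. One more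
ancestor adds `s`, which outweighs any difference of indices. -/
lemma gateRank_lt_of_edge {g h : Fin s} (hgh : C.edge (Sum.inr g) (Sum.inr h)) :
    C.gateRank g < C.gateRank h := by
  classical
  unfold gateRank
  have h1 : (Finset.univ.filter fun k : Fin s =>
      Relation.TransGen C.edge (Sum.inr k) (Sum.inr g)).card <
      (Finset.univ.filter fun k : Fin s =>
      Relation.TransGen C.edge (Sum.inr k) (Sum.inr h)).card := by
    refine Finset.card_lt_card (Finset.ssubset_iff_of_subset ?_ |>.2 ⟨g, ?_, ?_⟩)
    · intro k hk
      simp only [Finset.mem_filter, Finset.mem_univ, true_and] at hk ⊢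
      exact hk.tail hgh
    · simpa using Relation.TransGen.single hgh
    · simpa using C.acyclic _
  have := Nat.mul_le_mul_right s (Nat.succ_le_of_lt h1)
  rw [Nat.succ_mul] at this
  have := g.2
  omega

end ThresholdCircuit

/-! ### Sidon positions for the gates -/

/-- A polynomially growing Sidon sequence. -/
def sidon (A k : ℕ) : ℕ := A * k + k * k

lemma sidon_mono (A : ℕ) {k l : ℕ} (h : k ≤ l) : sidon A k ≤ sidon A l :=
  Nat.add_le_add (Nat.mul_le_mul_left _ h) (Nat.mul_le_mul h h)

/-- With `n < A`, gaps of this size keep a shift between two inputs from matching a shift between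
two gates. -/
lemma sidon_add_le (A : ℕ) {k l : ℕ} (h : k < l) : sidon A k + A ≤ sidon A l := by
  have : sidon A (k + 1) ≤ sidon A l := sidon_mono A h
  unfold sidon at *
  nlinarith

/-- The sums of squares are below `A`, so division by `A` separates the linear from the quadratic
part. Sum and sum of squares determine an unordered pair. -/
lemma sidon_add_eq {A S a b c d : ℕ} (hA : 2 * (S * S) < A) (ha : a < S) (hb : b < S) (hc : c < S)
    (hd : d < S) (h : sidon A a + sidon A b = sidon A c + sidon A d) :
    a = c ∧ b = d ∨ a = d ∧ b = c := by
  unfold sidon at h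
  have sq : ∀ {k}, k < S → k * k ≤ S * S := fun hk => Nat.mul_le_mul hk.le hk.le
  have h1 : A * (a + b) + (a * a + b * b) = A * (c + d) + (c * c + d * d) := by linarith
  have h2 : a + b = c + d := by
    have h3 := congrArg (· / A) h1
    rwa [Nat.mul_add_div (by omega), Nat.mul_add_div (by omega),
      Nat.div_eq_of_lt (by have := sq ha; have := sq hb; omega),
      Nat.div_eq_of_lt (by have := sq hc; have := sq hd; omega)] at h3
  have h4 : a * a + b * b = c * c + d * d := by
    rw [h2] at h1
    omega
  have h5 : ((a : ℤ) - c) * (a - d) = 0 := by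
    zify at h2 h4
    have : (b : ℤ) = c + d - a := by linarith
    rw [this] at h4
    nlinarith
  rcases mul_eq_zero.1 h5 with h6 | h6
  · left; omega
  · right; omega

/-- The padded input `1 0^{2K} x`. -/
def padded (K : ℕ) (x : List Bool) : List Bool :=
  true :: (List.replicate (2 * K) false ++ x)

lemma length_padded (K : ℕ) (x : List Bool) : (padded K x).length = 2 * K + x.length + 1 := by
  simp [padded]

namespace ThresholdCircuit

variable {n s : ℕ} (C : ThresholdCircuit n s)

lemma map_layout_range {pos : Fin n ⊕ Fin s → ℕ} (hinj : Function.Injective pos) {K : ℕ}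
    (hinput : ∀ i, pos (Sum.inl i) = 2 * K + 1 + i) (hgate : ∀ g, 2 * K + n + 1 ≤ pos (Sum.inr g))
    (x : Fin n → Bool) :
    (List.range (2 * K + n + 1)).map (C.layout pos x) = padded K (List.ofFn x) := by
  have h0 : ∀ v, 0 < pos v := by
    rintro (i | g)
    · rw [hinput]; omega
    · have := hgate g
      omega
  refine List.ext_getElem (by simp [length_padded]) fun t h1 h2 => ?_
  simp only [List.length_map, List.length_range] at h1
  rw [List.getElem_map, List.getElem_range]
  unfold padded at h2
  change _ = (true :: (List.replicate (2 * K) false ++ List.ofFn x))[t]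
  rcases t with _ | t
  · simp [layout]
  · rw [List.getElem_cons_succ]
    by_cases ht : t < 2 * K
    · rw [List.getElem_append_left (by simpa using ht), List.getElem_replicate, layout,
        decide_eq_false_iff_not]
      rintro (h | ⟨i | g, hv, -⟩)
      · omega
      · rw [hinput] at hv; omega
      · have := hgate g; omega
    · rw [List.getElem_append_right (by simpa using ht), List.getElem_ofFn]
      have h3 : t - 2 * K < n := by omega
      have h4 : t + 1 = pos (Sum.inl ⟨t - 2 * K, h3⟩) := by
        rw [hinput]; simp only; omega
      rw [h4, C.layout_pos hinj h0, C.val_inl]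
      simp

/-- Every circuit is an end-to-end iterated linear threshold, up to padding of the input. -/
theorem exists_linGen {S A K : ℕ} (hS : s * s + s ≤ S) (hA : 2 * (S * S) < A) (hn : n < A)
    (hK : 2 * sidon A S + 2 ≤ K) :
    ∃ f ∈ linClass (3 * K + n + 1), ∀ x, C.eval x = endToEnd f K (padded K (List.ofFn x)) := by
  have hr : ∀ g, C.gateRank g < S := fun g => (C.gateRank_lt g).trans_le hS
  have hσ : ∀ g, sidon A (C.gateRank g) ≤ sidon A S := fun g => sidon_mono A (hr g).le
  -- This offset puts the output gate at the last of the `K` generated positions.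
  obtain ⟨e, he⟩ : ∃ e, e + sidon A (C.gateRank C.out) = 2 * K + n + 1 + K - 1 :=
    ⟨2 * K + n + 1 + K - 1 - sidon A (C.gateRank C.out), by have := hσ C.out; omega⟩
  -- The gap between inputs and gates exceeds every distance between gates. The bound on `K` pays
  -- for one `sidon A S` here and one lost in the choice of `e`.
  have heN : 2 * K + n + 1 + sidon A S + 1 ≤ e := by
    have := hσ C.out
    omega
  let pos : Fin n ⊕ Fin s → ℕ :=
    Sum.elim (fun i => 2 * K + 1 + i) (fun g => e + sidon A (C.gateRank g))
  have pl : ∀ i, pos (Sum.inl i) = 2 * K + 1 + i := fun _ => rfl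
  have pr : ∀ g, pos (Sum.inr g) = e + sidon A (C.gateRank g) := fun _ => rfl
  have hlt : ∀ {g h}, C.gateRank g < C.gateRank h →
      pos (Sum.inr g) + A ≤ pos (Sum.inr h) := by
    intro g h hgh
    have := sidon_add_le A hgh
    rw [pr, pr]
    omega
  have hne : ∀ {g h}, g ≠ h → pos (Sum.inr g) + A ≤ pos (Sum.inr h) ∨
      pos (Sum.inr h) + A ≤ pos (Sum.inr g) := fun {g h} hgh =>
    (lt_or_gt_of_ne fun h' => hgh (C.gateRank_injective h')).imp hlt hlt
  have hinj : Function.Injective pos := by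
    rintro (i | g) (j | h) hij
    · rw [pl, pl] at hij
      congr 1
      exact Fin.ext (by omega)
    · rw [pl, pr] at hij; omega
    · rw [pl, pr] at hij; omega
    · by_contra hgh
      rcases hne fun h' => hgh (congrArg Sum.inr h') with h' | h' <;> omega
  have hgate : ∀ g, 2 * K + n + 1 ≤ pos (Sum.inr g) := fun g => by rw [pr]; omega
  have h0 : ∀ v, 0 < pos v := by
    rintro (i | g)
    · rw [pl]; omega
    · have := hgate g
      omega
  obtain ⟨W, hW⟩ := C.exists_weights (pos := pos) (N := 2 * K + n + 1) (by omega) hinj h0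
    (fun i => by rw [pl]; omega)
    (by
      rintro (i | h) g
      · rw [pl, pr]
        have := hσ g
        omega
      · rw [pr, pr]
        have := hσ g
        omega)
    (by
      rintro (i | h) g hg
      · rw [pl, pr]; omega
      · have := hlt (C.gateRank_lt_of_edge hg)
        omega)
    (by
      -- Two inputs: gates are more than `n` apart. An input and a gate: the gap `heN` rules out
      -- equal distances. Two gates: the Sidon property, where `hv` excludes the trivial solution.
      rintro (i | k) (j | l) g h - hv huv
      · by_cases hgh : h = g
        · subst hgh
          rw [pl, pl] at huv
          exact ⟨congrArg _ (Fin.ext (by omega)), rfl⟩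
        · have := i.2
          have := j.2
          rw [pl, pl] at huv
          rcases hne hgh with h' | h' <;> omega
      · rw [pl, pr, pr, pr] at huv
        have := hσ g
        omega
      · rw [pl, pr, pr, pr] at huv
        have := hσ h
        have := hσ k
        omega
      · rw [pr, pr] at hv
        rw [pr, pr, pr, pr] at huv
        rcases sidon_add_eq hA (hr k) (hr g) (hr h) (hr l) (by omega) with ⟨h1, h2⟩ | ⟨h1, h2⟩
        · rw [h2] at hv
          exact absurd hv (lt_irrefl _)
        · exact ⟨congrArg _ (C.gateRank_injective h1), C.gateRank_injective h2.symm⟩)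
  refine ⟨_, ⟨fun i => W (3 * K + n + 1 - i), 0, rfl⟩, fun x => ?_⟩
  rw [endToEnd, ← C.map_layout_range hinj pl hgate,
    chainOfThought_linGen (T := K) (by omega) W _ (hW x) K le_rfl]
  obtain ⟨k, rfl⟩ : ∃ k, K = k + 1 := ⟨K - 1, by omega⟩
  rw [← add_assoc, List.range_succ, List.map_append, List.map_singleton, List.getLastD_concat]
  have : 2 * (k + 1) + n + 1 + k = pos (Sum.inr C.out) := by
    rw [pr]; omega
  rw [this, C.layout_pos hinj h0]
  rfl

end ThresholdCircuit

/-! ### Programs for the transformation of samples -/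

/-- The unary representation of `n`. -/
abbrev unary (n : ℕ) : List Bool := List.replicate n true

/-- The store whose first stacks are listed, and whose other stacks are empty. -/
def st (l : List (List Bool)) : Store := fun r => l.getD r []

/-- This makes empty work stacks explicit, so that the programs below can be traced on lists of
fixed length. -/
lemma st_append_replicate (l : List (List Bool)) (k : ℕ) :
    st (l ++ List.replicate k []) = st l := by
  funext r
  unfold st
  by_cases hr : r < l.length
  · rw [List.getD_append _ _ _ _ hr]
  · rw [List.getD_append_right _ _ _ _ (by omega), List.getD_eq_default l _ (by omega)]
    by_cases h : r - l.length < k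
    · rw [List.getD_eq_getElem _ _ (by simpa using h), List.getElem_replicate]
    · rw [List.getD_eq_default _ _ (by simpa using h)]

lemma update_st {l : List (List Bool)} {r : ℕ} (hr : r < l.length) (v : List Bool) :
    Function.update (st l) r v = st (l.set r v) := by
  funext q
  unfold st
  by_cases hq : q = r
  · subst hq
    rw [Function.update_self, List.getD_eq_getElem _ _ (by simpa using hr), List.getElem_set_self]
  · rw [Function.update_of_ne hq]
    simp only [List.getD_eq_getElem?_getD]
    rw [List.getElem?_set_ne (fun h => hq h.symm)]

/-- Started in `σ`, the program `P` halts in `τ` after at most `t` steps. -/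
def Runs (P : Prog) (σ : Store) (t : ℕ) (τ : Store) : Prop := ∃ t' ≤ t, Exec P σ t' τ

namespace Runs

lemma weaken {P : Prog} {σ τ : Store} {t u : ℕ} (h : Runs P σ t τ) (htu : t ≤ u) :
    Runs P σ u τ :=
  let ⟨t', ht, h⟩ := h
  ⟨t', ht.trans htu, h⟩

lemma seq {P Q : Prog} {σ τ υ : Store} {t u : ℕ} (hP : Runs P σ t τ) (hQ : Runs Q τ u υ) :
    Runs (Prog.seq P Q) σ (t + u) υ :=
  let ⟨t', ht, hP⟩ := hP
  let ⟨u', hu, hQ⟩ := hQ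
  ⟨t' + u', Nat.add_le_add ht hu, hP.seq hQ⟩

lemma skip (σ : Store) : Runs Prog.skip σ 1 σ := ⟨1, le_rfl, Exec.skip σ⟩

lemma push {r : ℕ} {b : Bool} {l : List (List Bool)} (hr : r < l.length := by simp) :
    Runs (Prog.push r b) (st l) 1 (st (l.set r (b :: l.getD r []))) :=
  ⟨1, le_rfl, update_st hr _ ▸ Exec.push r b (st l)⟩

lemma pop {r : ℕ} {l : List (List Bool)} (hr : r < l.length := by simp) :
    Runs (Prog.pop r) (st l) 1 (st (l.set r (l.getD r []).tail)) :=
  ⟨1, le_rfl, update_st hr _ ▸ Exec.pop r (st l)⟩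

/-- A loop that is repeated `i` times; `σ i j` is the store when `i` rounds are left and `j` rounds
have been made. -/
lemma loop_nat {r t : ℕ} {P : Prog} (σ : ℕ → ℕ → Store) (h0 : ∀ j, σ 0 j r = [])
    (h1 : ∀ i j, σ (i + 1) j r ≠ []) (h : ∀ i j, Runs P (σ (i + 1) j) t (σ i (j + 1))) (i : ℕ) :
    ∀ j, Runs (Prog.loop r P) (σ i j) (i * (t + 1) + 1) (σ 0 (j + i)) := by
  induction i with
  | zero => exact fun j => ⟨1, by omega, Exec.loop_stop (h0 j)⟩
  | succ i ih =>
    intro j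
    obtain ⟨t', ht, hP⟩ := h i j
    obtain ⟨u, hu, hL⟩ := ih (j + 1)
    rw [add_assoc, add_comm 1 i] at hL
    refine ⟨t' + u + 1, ?_, Exec.loop_step (h1 i j) hP hL⟩
    rw [Nat.succ_mul]
    omega

/-- A loop that processes a list; `σ l m` is the store when `l` is left to be processed and `m` has
been produced. -/
lemma loop_list {α β : Type*} {r t : ℕ} {P : Prog} (σ : List α → β → Store) (F : β → α → β)
    (h0 : ∀ m, σ [] m r = []) (h1 : ∀ a l m, σ (a :: l) m r ≠ [])
    (h : ∀ a l m, Runs P (σ (a :: l) m) t (σ l (F m a))) (l : List α) :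
    ∀ m, Runs (Prog.loop r P) (σ l m) (l.length * (t + 1) + 1) (σ [] (l.foldl F m)) := by
  induction l with
  | nil => exact fun m => ⟨1, by omega, Exec.loop_stop (h0 m)⟩
  | cons a l ih =>
    intro m
    obtain ⟨t', ht, hP⟩ := h a l m
    obtain ⟨u, hu, hL⟩ := ih (F m a)
    refine ⟨t' + u + 1, ?_, Exec.loop_step (h1 a l m) hP hL⟩
    rw [List.length_cons, Nat.succ_mul]
    omega

end Runs

namespace Prog

/-- Move the top of stack `a` to stack `b`. -/
def move (a b : ℕ) : Prog :=
  branch a skip (seq (pop a) (push b false)) (seq (pop a) (push b true))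

/-- Move the contents of stack `a` to stack `b`, bit by bit. -/
def moveAll (a b : ℕ) : Prog := loop a (move a b)

end Prog

lemma Runs.move {a b : ℕ} {l : List (List Bool)} {x : Bool} (hx : (l.getD a []).head? = some x)
    (ha : a < l.length := by simp) (hb : b < l.length := by simp) :
    Runs (Prog.move a b) (st l) 3
      (st ((l.set a (l.getD a []).tail).set b
        (x :: (l.set a (l.getD a []).tail).getD b []))) := by
  have h : ∀ y, Runs (Prog.seq (Prog.pop a) (Prog.push b y)) (st l) 2
      (st ((l.set a (l.getD a []).tail).set b
        (y :: (l.set a (l.getD a []).tail).getD b []))) :=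
    fun y => (Runs.pop ha).seq (Runs.push (by simpa using hb))
  obtain ⟨t, ht, h'⟩ := h x
  cases x
  · exact ⟨t + 1, by omega, Exec.branch_zero hx h'⟩
  · exact ⟨t + 1, by omega, Exec.branch_one hx h'⟩

lemma foldl_cons (l m : List Bool) : l.foldl (fun m a => a :: m) m = l.reverse ++ m := by
  induction l generalizing m with
  | nil => rfl
  | cons a l ih => simp [ih]

/-- `moveAll` reverses a string onto another stack. -/
lemma Runs.moveAll {a b : ℕ} (σ : List Bool → List Bool → List (List Bool))
    (hσ : ∀ l m, (σ l m).getD a [] = l) (ha : ∀ l m, a < (σ l m).length)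
    (hb : ∀ l m, b < (σ l m).length)
    (h : ∀ x l m, ((σ (x :: l) m).set a l).set b (x :: ((σ (x :: l) m).set a l).getD b []) =
      σ l (x :: m)) (l m : List Bool) :
    Runs (Prog.moveAll a b) (st (σ l m)) (4 * l.length + 1) (st (σ [] (l.reverse ++ m))) := by
  have := Runs.loop_list (r := a) (t := 3) (P := Prog.move a b) (fun l m => st (σ l m))
    (fun m x => x :: m) (fun m => hσ [] m) (fun x l m => by
      show (σ (x :: l) m).getD a [] ≠ []
      rw [hσ]
      exact List.cons_ne_nil _ _)
    (fun x l m => by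
      have := Runs.move (a := a) (b := b) (l := σ (x :: l) m) (x := x) (by rw [hσ]; rfl)
        (ha _ _) (hb _ _)
      rwa [hσ, List.tail_cons, h] at this) l m
  rw [foldl_cons] at this
  exact this.weaken (by omega)

lemma reverse_unary (n : ℕ) : (unary n).reverse = unary n := List.reverse_replicate

lemma length_unary (n : ℕ) : (unary n).length = n := List.length_replicate

/-! ### Unary arithmetic on stacks -/

namespace Prog

/-- Multiply the number on stack `5` by the number on stack `0`. -/
def mul : Prog :=
  seq (loop 5 (seq (pop 5) (seq (loop 0 (seq (pop 0) (seq (push 7 true) (push 6 true))))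
    (moveAll 7 0)))) (moveAll 6 5)

/-- Put the number `c` onto stack `5`. -/
def const : ℕ → Prog
  | 0 => skip
  | c + 1 => seq (const c) (push 5 true)

/-- Put the number `c * n ^ k` onto stack `5`, where `n` is the number on stack `0`. -/
def monomial (c : ℕ) : ℕ → Prog
  | 0 => const c
  | k + 1 => seq (monomial c k) mul

end Prog

/-- Each of the `a` rounds empties stack `0` onto stack `6`, which accumulates the product, and onto
stack `7`, from which stack `0` is restored. -/
lemma runs_mul (n a : ℕ) (u v w x y : List Bool) :
    Runs Prog.mul (st [unary n, u, v, w, x, unary a, [], [], y]) (a * (12 * n + 4) + 2)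
      (st [unary n, u, v, w, x, unary (n * a), [], [], y]) := by
  have h1 : ∀ i j, Runs (Prog.loop 0 (Prog.seq (Prog.pop 0)
      (Prog.seq (Prog.push 7 true) (Prog.push 6 true))))
      (st [unary n, u, v, w, x, unary i, unary j, [], y]) (n * 4 + 1)
      (st [[], u, v, w, x, unary i, unary (j + n), unary n, y]) := by
    intro i j
    have := Runs.loop_nat (r := 0) (t := 3) (P := Prog.seq (Prog.pop 0)
      (Prog.seq (Prog.push 7 true) (Prog.push 6 true)))
      (fun p q => st [unary p, u, v, w, x, unary i, unary (j + q), unary q, y])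
      (fun _ => rfl) (fun _ _ => List.cons_ne_nil _ _)
      (fun p q => Runs.seq Runs.pop (Runs.seq Runs.push Runs.push)) n 0
    rwa [Nat.zero_add] at this
  have h2 : ∀ i j, Runs (Prog.moveAll 7 0)
      (st [[], u, v, w, x, unary i, unary j, unary n, y]) (4 * n + 1)
      (st [unary n, u, v, w, x, unary i, unary j, [], y]) := by
    intro i j
    have := Runs.moveAll (a := 7) (b := 0)
      (fun l m => [m, u, v, w, x, unary i, unary j, l, y]) (fun _ _ => rfl) (fun _ _ => by simp)
      (fun _ _ => by simp) (fun _ _ _ => rfl) (unary n) []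
    rwa [reverse_unary, length_unary, List.append_nil] at this
  have h3 : Runs (Prog.moveAll 6 5)
      (st [unary n, u, v, w, x, [], unary (n * a), [], y]) (4 * (n * a) + 1)
      (st [unary n, u, v, w, x, unary (n * a), [], [], y]) := by
    have := Runs.moveAll (a := 6) (b := 5)
      (fun l m => [unary n, u, v, w, x, m, l, [], y]) (fun _ _ => rfl) (fun _ _ => by simp)
      (fun _ _ => by simp) (fun _ _ _ => rfl) (unary (n * a)) []
    rwa [reverse_unary, length_unary, List.append_nil] at this
  have h4 := Runs.loop_nat (r := 5) (P := Prog.seq (Prog.pop 5)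
    (Prog.seq (Prog.loop 0 (Prog.seq (Prog.pop 0) (Prog.seq (Prog.push 7 true)
      (Prog.push 6 true)))) (Prog.moveAll 7 0)))
      (fun p q => st [unary n, u, v, w, x, unary p, unary (n * q), [], y])
      (fun _ => rfl) (fun _ _ => List.cons_ne_nil _ _)
      (fun p q => Runs.seq Runs.pop ((h1 p (n * q)).seq (h2 p (n * (q + 1))))) a 0
  rw [Nat.zero_add] at h4
  refine (h4.seq h3).weaken (le_of_eq ?_)
  ring

lemma runs_const (c : ℕ) (u v w x y z : List Bool) :
    Runs (Prog.const c) (st [u, v, w, x, y, [], [], [], z]) (c + 1)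
      (st [u, v, w, x, y, unary c, [], [], z]) := by
  induction c with
  | zero => exact Runs.skip _
  | succ c ih => exact ih.seq Runs.push

lemma runs_monomial {n : ℕ} (hn : 0 < n) (c k : ℕ) (u v w x y : List Bool) :
    Runs (Prog.monomial c k) (st [unary n, u, v, w, x, [], [], [], y])
      (c + 1 + k * (c * n ^ k * (12 * n + 4) + 2))
      (st [unary n, u, v, w, x, unary (c * n ^ k), [], [], y]) := by
  induction k with
  | zero =>
    rw [pow_zero, mul_one]
    exact (runs_const c _ _ _ _ _ _).weaken (by omega)
  | succ k ih =>
    have := ih.seq (runs_mul n (c * n ^ k) u v w x y)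
    rw [show n * (c * n ^ k) = c * n ^ (k + 1) by ring] at this
    refine this.weaken ?_
    -- As `n ≥ 1`, intermediate products do not exceed the final one, so every multiplication can be
    -- charged at the final size.
    have h : c * n ^ k * (12 * n + 4) ≤ c * n ^ (k + 1) * (12 * n + 4) :=
      Nat.mul_le_mul_right _ (Nat.mul_le_mul_left _ (Nat.pow_le_pow_right hn k.le_succ))
    have h' := Nat.mul_le_mul_left k (Nat.add_le_add_right h 2)
    rw [Nat.succ_mul k]
    omega

/-! ### Padding of samples, points and parameters -/

namespace Prog

/-- Put the padding `1 0^{2K}` onto stack `r`, where `K` is the number on stack `5`. -/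
def pad (r : ℕ) : Prog :=
  seq (loop 5 (seq (pop 5) (seq (push 6 true) (seq (push r false) (push r false)))))
    (seq (moveAll 6 5) (push r true))

/-- Pad all inputs of the sample on stack `1`; the result is on stack `3`. -/
def padSample : Prog :=
  seq (moveAll 1 8) (loop 8 (seq (move 8 3)
    (seq (loop 0 (seq (pop 0) (seq (push 6 true) (move 8 3)))) (seq (moveAll 6 0) (pad 3)))))

/-- Replace the parameter `n` by `n + 1 + 2 K`, `n + 1 + 3 K`, `K`, where `K` is the number on
stack `5`. -/
def params : Prog :=
  seq (push 0 true) (seq (loop 0 (seq (pop 0) (seq (push 6 true) (push 1 true))))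
    (seq (moveAll 6 0) (loop 5 (seq (pop 5) (seq (push 0 true) (seq (push 0 true)
      (seq (push 1 true) (seq (push 1 true) (seq (push 1 true) (push 2 true))))))))))

end Prog

lemma runs_pad_three (K : ℕ) (u v w x y z : List Bool) :
    Runs (Prog.pad 3) (st [u, v, w, x, y, unary K, [], [], z]) (9 * K + 3)
      (st [u, v, w, padded K x, y, unary K, [], [], z]) := by
  have h1 := Runs.loop_nat (r := 5) (P := Prog.seq (Prog.pop 5)
    (Prog.seq (Prog.push 6 true) (Prog.seq (Prog.push 3 false) (Prog.push 3 false))))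
    (fun p q => st [u, v, w, List.replicate (2 * q) false ++ x, y, unary p, unary q, [], z])
    (fun _ => rfl) (fun _ _ => List.cons_ne_nil _ _)
    (fun p q => Runs.seq Runs.pop (Runs.seq Runs.push (Runs.seq Runs.push Runs.push))) K 0
  rw [Nat.zero_add] at h1
  have h2 := Runs.moveAll (a := 6) (b := 5)
    (fun l m => [u, v, w, List.replicate (2 * K) false ++ x, y, m, l, [], z])
    (fun _ _ => rfl) (fun _ _ => by simp)
    (fun _ _ => by simp) (fun _ _ _ => rfl) (unary K) []
  rw [reverse_unary, length_unary, List.append_nil] at h2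
  exact (h1.seq (h2.seq Runs.push)).weaken (by omega)

lemma runs_pad_four (K : ℕ) (u v w x y z : List Bool) :
    Runs (Prog.pad 4) (st [u, v, w, x, y, unary K, [], [], z]) (9 * K + 3)
      (st [u, v, w, x, padded K y, unary K, [], [], z]) := by
  have h1 := Runs.loop_nat (r := 5) (P := Prog.seq (Prog.pop 5)
    (Prog.seq (Prog.push 6 true) (Prog.seq (Prog.push 4 false) (Prog.push 4 false))))
    (fun p q => st [u, v, w, x, List.replicate (2 * q) false ++ y, unary p, unary q, [], z])
    (fun _ => rfl) (fun _ _ => List.cons_ne_nil _ _)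
    (fun p q => Runs.seq Runs.pop (Runs.seq Runs.push (Runs.seq Runs.push Runs.push))) K 0
  rw [Nat.zero_add] at h1
  have h2 := Runs.moveAll (a := 6) (b := 5)
    (fun l m => [u, v, w, x, List.replicate (2 * K) false ++ y, m, l, [], z])
    (fun _ _ => rfl) (fun _ _ => by simp)
    (fun _ _ => by simp) (fun _ _ _ => rfl) (unary K) []
  rw [reverse_unary, length_unary, List.append_nil] at h2
  exact (h1.seq (h2.seq Runs.push)).weaken (by omega)

lemma runs_params (n K : ℕ) (x y z : List Bool) :
    Runs Prog.params (st [unary n, [], [], x, y, unary K, [], [], z]) (8 * n + 8 * K + 12)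
      (st [unary (n + 1 + 2 * K), unary (n + 1 + 3 * K), unary K, x, y, [], [], [], z]) := by
  have h1 := Runs.loop_nat (r := 0) (P := Prog.seq (Prog.pop 0)
    (Prog.seq (Prog.push 6 true) (Prog.push 1 true)))
    (fun p q => st [unary p, unary q, [], x, y, unary K, unary q, [], z])
    (fun _ => rfl) (fun _ _ => List.cons_ne_nil _ _)
    (fun p q => Runs.seq Runs.pop (Runs.seq Runs.push Runs.push)) (n + 1) 0
  rw [Nat.zero_add] at h1
  have h2 := Runs.moveAll (a := 6) (b := 0)
    (fun l m => [m, unary (n + 1), [], x, y, unary K, l, [], z])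
    (fun _ _ => rfl) (fun _ _ => by simp)
    (fun _ _ => by simp) (fun _ _ _ => rfl) (unary (n + 1)) []
  rw [reverse_unary, length_unary, List.append_nil] at h2
  have h3 := Runs.loop_nat (r := 5) (P := Prog.seq (Prog.pop 5) (Prog.seq (Prog.push 0 true)
    (Prog.seq (Prog.push 0 true) (Prog.seq (Prog.push 1 true) (Prog.seq (Prog.push 1 true)
      (Prog.seq (Prog.push 1 true) (Prog.push 2 true)))))))
    (fun p q => st [unary (n + 1 + 2 * q), unary (n + 1 + 3 * q), unary q, x, y, unary p, [], [],
      z])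
    (fun _ => rfl) (fun _ _ => List.cons_ne_nil _ _)
    (fun p q => Runs.seq Runs.pop (Runs.seq Runs.push (Runs.seq Runs.push (Runs.seq Runs.push
      (Runs.seq Runs.push (Runs.seq Runs.push Runs.push)))))) K 0
  rw [Nat.zero_add] at h3
  exact (Runs.seq Runs.push (h1.seq (h2.seq h3))).weaken (by omega)

/-- A sample as one string. -/
def encode (es : List (List Bool × Bool)) : List Bool := (es.map fun e => e.1 ++ [e.2]).flatten

lemma length_encode {n : ℕ} {es : List (List Bool × Bool)} (h : ∀ e ∈ es, e.1.length = n) :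
    (encode es).length = es.length * (n + 1) := by
  induction es with
  | nil => simp [encode]
  | cons e es ih =>
    have h1 := h e (by simp)
    have h2 := ih fun e he => h e (by simp [he])
    unfold encode at *
    rw [List.map_cons, List.flatten_cons, List.length_append, h2, List.length_cons, Nat.succ_mul]
    simp [h1]
    omega

lemma reverse_encode (es : List (List Bool × Bool)) :
    (encode es).reverse = (es.reverse.map fun e => e.2 :: e.1.reverse).flatten := by
  simp [encode, List.reverse_flatten, Function.comp_def]

/-- Padding only adds bits at the front, so it can be applied with the examples produced so far
still lying underneath. -/
lemma foldl_encode (K : ℕ) (es : List (List Bool × Bool)) (m : List Bool) :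
    es.foldl (fun m e => padded K (e.1 ++ e.2 :: m)) m =
      encode (es.reverse.map fun e => (padded K e.1, e.2)) ++ m := by
  induction es generalizing m with
  | nil => rfl
  | cons e es ih =>
    rw [List.foldl_cons, ih]
    simp [encode, padded]

/-- The counter on stack `0` stops the reading at the end of the current input; stack `6` saves the
count for the next one. -/
lemma runs_readInput (l : List Bool) (u v w x y z : List Bool) (j : ℕ) :
    Runs (Prog.loop 0 (Prog.seq (Prog.pop 0) (Prog.seq (Prog.push 6 true) (Prog.move 8 3))))
      (st [unary l.length, u, v, w, x, y, unary j, [], l ++ z]) (6 * l.length + 1)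
      (st [[], u, v, l.reverse ++ w, x, y, unary (j + l.length), [], z]) := by
  have := Runs.loop_list (r := 0) (P := Prog.seq (Prog.pop 0)
    (Prog.seq (Prog.push 6 true) (Prog.move 8 3)))
    (fun (l : List Bool) (m : List Bool × ℕ) =>
      st [unary l.length, u, v, m.1, x, y, unary m.2, [], l ++ z])
    (fun m a => (a :: m.1, m.2 + 1))
    (fun _ => rfl) (fun _ _ _ => List.cons_ne_nil _ _)
    (fun a l m => Runs.seq Runs.pop (Runs.seq Runs.push (Runs.move (x := a) rfl))) l (w, j)
  have h : ∀ (l w : List Bool) (j : ℕ),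
      l.foldl (fun (m : List Bool × ℕ) a => (a :: m.1, m.2 + 1)) (w, j) =
        (l.reverse ++ w, j + l.length) := by
    intro l
    induction l with
    | nil => exact fun _ _ => rfl
    | cons a l ih =>
      intro w j
      rw [List.foldl_cons, ih]
      simp
      omega
  rw [h] at this
  exact this.weaken (by omega)

lemma runs_padSample {n K : ℕ} {es : List (List Bool × Bool)} (hes : ∀ e ∈ es, e.1.length = n)
    (u v : List Bool) :
    Runs Prog.padSample (st [unary n, encode es, u, [], v, unary K, [], [], []])
      (es.length * (14 * n + 9 * K + 13) + 2)
      (st [unary n, [], u, encode (es.map fun e => (padded K e.1, e.2)), v, unary K, [], [],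
        []]) := by
  have hes' := hes
  -- `loop_list` asks for one time bound valid for all elements, so the length condition is moved
  -- into the type.
  lift es to List {e : List Bool × Bool // e.1.length = n} using hes with L
  have h1 := Runs.moveAll (a := 1) (b := 8)
    (fun l m => [unary n, l, u, [], v, unary K, [], [], m])
    (fun _ _ => rfl) (fun _ _ => by simp)
    (fun _ _ => by simp) (fun _ _ _ => rfl) (encode (L.map Subtype.val)) []
  rw [List.append_nil, length_encode hes', reverse_encode] at h1
  have h2 := Runs.loop_list (r := 8) (t := 10 * n + 9 * K + 8)
    (P := Prog.seq (Prog.move 8 3)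
      (Prog.seq (Prog.loop 0 (Prog.seq (Prog.pop 0) (Prog.seq (Prog.push 6 true)
        (Prog.move 8 3)))) (Prog.seq (Prog.moveAll 6 0) (Prog.pad 3))))
    (fun (l : List {e : List Bool × Bool // e.1.length = n}) m =>
      st [unary n, [], u, m, v, unary K, [], [], (l.map fun e => e.1.2 :: e.1.1.reverse).flatten])
    (fun m e => padded K (e.1.1 ++ e.1.2 :: m))
    (fun _ => rfl) (fun _ _ _ => List.cons_ne_nil _ _)
    (by
      rintro ⟨⟨e, b⟩, he⟩ l m
      simp only at he
      have h3 := runs_readInput e.reverse [] u (b :: m) v (unary K)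
        (l.map fun e => e.1.2 :: e.1.1.reverse).flatten 0
      rw [List.length_reverse, he, Nat.zero_add, List.reverse_reverse] at h3
      have h4 := Runs.moveAll (a := 6) (b := 0)
        (fun p q => [q, [], u, e ++ b :: m, v, unary K, p, [],
          (l.map fun e => e.1.2 :: e.1.1.reverse).flatten])
        (fun _ _ => rfl) (fun _ _ => by simp)
        (fun _ _ => by simp) (fun _ _ _ => rfl) (unary n) []
      rw [reverse_unary, length_unary, List.append_nil] at h4
      exact ((Runs.move (x := b) rfl).seq
        (h3.seq (h4.seq (runs_pad_three K _ _ _ _ _ _)))).weaken (by omega))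
    L.reverse []
  have h5 : ((L.map Subtype.val).reverse.map fun e : List Bool × Bool =>
      e.2 :: e.1.reverse).flatten = (L.reverse.map fun e => e.1.2 :: e.1.1.reverse).flatten := by
    rw [← List.map_reverse, List.map_map]
    rfl
  have h6 : L.reverse.foldl (fun m e => padded K (e.1.1 ++ e.1.2 :: m)) [] =
      encode ((L.map Subtype.val).map fun e : List Bool × Bool => (padded K e.1, e.2)) := by
    have := foldl_encode K (L.reverse.map Subtype.val) []
    rwa [List.foldl_map, ← List.map_reverse, List.reverse_reverse, List.append_nil] at this
  rw [h6, ← h5, List.length_reverse] at h2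
  rw [List.length_map] at h1 ⊢
  refine (h1.seq h2).weaken (le_of_eq ?_)
  ring

namespace Prog

/-- The transformation of the training input: from `1^n`, a sample and random bits to the unary
parameters for padded inputs, the padded sample and the same random bits. -/
def padTrain (c k : ℕ) : Prog :=
  seq (monomial c k) (seq padSample (seq (moveAll 2 8) (seq (moveAll 8 4) params)))

/-- The transformation of the input of the hypothesis. -/
def padPredict (c k : ℕ) : Prog :=
  seq (monomial c k) (seq (moveAll 1 8) (seq (moveAll 8 3) (seq (moveAll 2 8)
    (seq (moveAll 8 4) (seq (pad 4) params)))))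

end Prog

lemma runs_padTrain {n c k K : ℕ} (hn : 0 < n) (hK : c * n ^ k = K)
    {es : List (List Bool × Bool)} (hes : ∀ e ∈ es, e.1.length = n) (coins : List Bool) :
    Runs (Prog.padTrain c k) (st [unary n, encode es, coins])
      (c + 1 + k * (K * (12 * n + 4) + 2) + (es.length * (14 * n + 9 * K + 13) + 2) +
        8 * coins.length + (8 * n + 8 * K + 14))
      (st [unary (n + 1 + 2 * K), unary (n + 1 + 3 * K), unary K,
        encode (es.map fun e => (padded K e.1, e.2)), coins]) := by
  subst hK
  have h1 := runs_monomial hn c k (encode es) coins [] [] []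
  have h2 := runs_padSample (K := c * n ^ k) hes coins []
  have h3 := Runs.moveAll (a := 2) (b := 8)
    (fun l m => [unary n, [], l, encode (es.map fun e => (padded (c * n ^ k) e.1, e.2)), [],
      unary (c * n ^ k), [], [], m])
    (fun _ _ => rfl) (fun _ _ => by simp)
    (fun _ _ => by simp) (fun _ _ _ => rfl) coins []
  have h4 := Runs.moveAll (a := 8) (b := 4)
    (fun l m => [unary n, [], [], encode (es.map fun e => (padded (c * n ^ k) e.1, e.2)), m,
      unary (c * n ^ k), [], [], l])
    (fun _ _ => rfl) (fun _ _ => by simp)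
    (fun _ _ => by simp) (fun _ _ _ => rfl) coins.reverse []
  rw [List.append_nil] at h3
  rw [List.append_nil, List.reverse_reverse, List.length_reverse] at h4
  have h5 := runs_params n (c * n ^ k)
    (encode (es.map fun e => (padded (c * n ^ k) e.1, e.2))) coins []
  have h := (h1.seq (h2.seq (h3.seq (h4.seq h5)))).weaken (u := _) (by
    show _ ≤ c + 1 + k * (c * n ^ k * (12 * n + 4) + 2) +
      (es.length * (14 * n + 9 * (c * n ^ k) + 13) + 2) +
        8 * coins.length + (8 * n + 8 * (c * n ^ k) + 14)
    omega)
  rw [← st_append_replicate [unary n, encode es, coins] 6,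
    ← st_append_replicate [_, _, _, _, coins] 4]
  exact h

lemma runs_padPredict {n c k K : ℕ} (hn : 0 < n) (hK : c * n ^ k = K) {x : List Bool}
    (hx : x.length = n) (rep : List Bool) :
    Runs (Prog.padPredict c k) (st [unary n, rep, x])
      (c + 1 + k * (K * (12 * n + 4) + 2) + 8 * rep.length + (16 * n + 17 * K + 19))
      (st [unary (n + 1 + 2 * K), unary (n + 1 + 3 * K), unary K, rep, padded K x]) := by
  subst hK
  have h1 := runs_monomial hn c k rep x [] [] []
  have h2 := Runs.moveAll (a := 1) (b := 8)
    (fun l m => [unary n, l, x, [], [], unary (c * n ^ k), [], [], m])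
    (fun _ _ => rfl) (fun _ _ => by simp)
    (fun _ _ => by simp) (fun _ _ _ => rfl) rep []
  have h3 := Runs.moveAll (a := 8) (b := 3)
    (fun l m => [unary n, [], x, m, [], unary (c * n ^ k), [], [], l])
    (fun _ _ => rfl) (fun _ _ => by simp)
    (fun _ _ => by simp) (fun _ _ _ => rfl) rep.reverse []
  have h4 := Runs.moveAll (a := 2) (b := 8)
    (fun l m => [unary n, [], l, rep, [], unary (c * n ^ k), [], [], m])
    (fun _ _ => rfl) (fun _ _ => by simp)
    (fun _ _ => by simp) (fun _ _ _ => rfl) x []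
  have h5 := Runs.moveAll (a := 8) (b := 4)
    (fun l m => [unary n, [], [], rep, m, unary (c * n ^ k), [], [], l])
    (fun _ _ => rfl) (fun _ _ => by simp)
    (fun _ _ => by simp) (fun _ _ _ => rfl) x.reverse []
  rw [List.append_nil] at h2 h4
  rw [List.append_nil, List.reverse_reverse, List.length_reverse] at h3 h5
  have h6 := runs_pad_four (c * n ^ k) (unary n) [] [] rep x []
  have h7 := runs_params n (c * n ^ k) rep (padded (c * n ^ k) x) []
  have h := (h1.seq (h2.seq (h3.seq (h4.seq (h5.seq (h6.seq h7)))))).weaken (u := _) (by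
    show _ ≤ c + 1 + k * (c * n ^ k * (12 * n + 4) + 2) + 8 * rep.length +
      (16 * n + 17 * (c * n ^ k) + 19)
    omega)
  rw [← st_append_replicate [unary n, rep, x] 6,
    ← st_append_replicate [_, _, _, rep, padded _ _] 4]
  exact h

/-- In `t` steps a stack grows by at most `t` bits. -/
lemma Exec.length_le {P : Prog} {σ τ : Store} {t : ℕ} (h : Exec P σ t τ) (q : ℕ) :
    (τ q).length ≤ (σ q).length + t := by
  induction h with
  | skip σ => omega
  | push r b σ =>
    by_cases hq : q = r
    · subst hq; simp
    · rw [Function.update_of_ne hq]; omega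
  | pop r σ =>
    by_cases hq : q = r
    · subst hq; simp; omega
    · rw [Function.update_of_ne hq]; omega
  | seq _ _ ih1 ih2 => omega
  | branch_nil _ _ ih => omega
  | branch_zero _ _ ih => omega
  | branch_one _ _ ih => omega
  | loop_stop _ => omega
  | loop_step _ _ _ ih1 ih2 => omega

/-! ### The reduction -/

lemma Runs.outputs {P Q : Prog} {inp inp' : List (List Bool)} {t u : ℕ} {out : List Bool}
    (h : Runs P (st inp) t (st inp')) (hQ : Q.Outputs inp' u out) :
    (Prog.seq P Q).Outputs inp (t + u) out := by
  obtain ⟨t', ht, hP⟩ := h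
  obtain ⟨u', hu, τ, hQ, hout⟩ := hQ
  exact ⟨t' + u', Nat.add_le_add ht hu, τ, hP.seq hQ, hout⟩

lemma Prog.Outputs.weaken {P : Prog} {inp : List (List Bool)} {t u : ℕ} {out : List Bool}
    (h : P.Outputs inp t out) (htu : t ≤ u) : P.Outputs inp u out :=
  let ⟨t', ht, h⟩ := h
  ⟨t', ht.trans htu, h⟩

/-- This bounds the representation of a hypothesis, which `padPredict` has to move between stacks.
-/
lemma Prog.Outputs.length_le {P : Prog} {inp : List (List Bool)} {t : ℕ} {out : List Bool}
    (h : P.Outputs inp t out) : out.length ≤ (inp.getD 0 []).length + t := by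
  obtain ⟨t', ht, τ, h, rfl⟩ := h
  have := h.length_le 0
  omega

/-- A bound for the running time of a learner that pads its inputs. -/
def paddedTime {R : Type*} [CommSemiring R] (c k n K t r : R) : R :=
  2 * (c + 1 + k * (K * (12 * n + 4) + 2)) + (t * (14 * n + 9 * K + 13) + 2) + 8 * r +
    (8 * n + 8 * K + 14) + 8 * (n + 1 + 2 * K + t) + (16 * n + 17 * K + 19) + t

/-- A learner that pads its inputs before calling `A`. -/
def Learner.padded (A : Learner) (c k : ℕ) : Learner where
  train := Prog.seq (Prog.padTrain c k) A.train
  predict := Prog.seq (Prog.padPredict c k) A.predict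

/-- Padding, as a map between cubes. -/
def padMap (K : ℕ) {n N : ℕ} (x : Fin n → Bool) (i : Fin N) : Bool :=
  (_root_.padded K (List.ofFn x)).getD i false

lemma ofFn_padMap {K n N : ℕ} (hN : N = n + 1 + 2 * K) (x : Fin n → Bool) :
    List.ofFn (padMap K x : Fin N → Bool) = padded K (List.ofFn x) := by
  have hl : (padded K (List.ofFn x)).length = N := by
    rw [length_padded, List.length_ofFn]; omega
  refine List.ext_getElem (by rw [List.length_ofFn, hl]) fun i h1 h2 => ?_
  rw [List.getElem_ofFn, padMap, List.getD_eq_getElem _ _ h2]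

lemma sampleBits_eq_encode {n m : ℕ} (f : (Fin n → Bool) → Bool) (xs : Fin m → Fin n → Bool) :
    sampleBits f xs = encode (List.ofFn fun j => (List.ofFn (xs j), f (xs j))) := by
  simp [sampleBits, encode, List.map_ofFn, Function.comp_def]

lemma sampleBits_padMap {K n N m : ℕ} (hN : N = n + 1 + 2 * K) {f : (Fin n → Bool) → Bool}
    {g : (Fin N → Bool) → Bool} (hfg : ∀ x, f x = g (padMap K x)) (xs : Fin m → Fin n → Bool) :
    sampleBits g (fun j => padMap K (xs j)) = encode ((List.ofFn fun j =>
      (List.ofFn (xs j), f (xs j))).map fun e => (padded K e.1, e.2)) := by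
  simp only [sampleBits_eq_encode, List.map_ofFn, Function.comp_def, ofFn_padMap hN, hfg]

lemma Learner.Returns.padded {A : Learner} {c k K t m : ℕ} {a : Fin 1 → ℕ} {a' : Fin 3 → ℕ}
    (ha : 0 < a 0) (hK : c * a 0 ^ k = K) (h0 : a' 0 = a 0 + 1 + 2 * K)
    (h1 : a' 1 = a 0 + 1 + 3 * K) (h2 : a' 2 = K) (hm : m ≤ t)
    {f : (Fin (a 0) → Bool) → Bool} {g : (Fin (a' 0) → Bool) → Bool}
    (hfg : ∀ x, f x = g (padMap K x)) {xs : Fin m → Fin (a 0) → Bool} {coins : List Bool}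
    {h : (Fin (a' 0) → Bool) → Bool}
    (hA : A.Returns a' t (sampleBits g fun j => padMap K (xs j)) coins h) :
    (A.padded c k).Returns a (paddedTime c k (a 0) K t coins.length) (sampleBits f xs) coins
      fun x => h (padMap K x) := by
  obtain ⟨rep, htrain, hpredict⟩ := hA
  have hp : paramBits a = [unary (a 0)] := rfl
  have hp' : paramBits a' = [unary (a 0 + 1 + 2 * K), unary (a 0 + 1 + 3 * K), unary K] := by
    rw [← h0, ← h1, ← h2]; rfl
  rw [hp', List.cons_append, List.cons_append, List.cons_append, List.nil_append] at htrain
  have hrep : rep.length ≤ a 0 + 1 + 2 * K + t := by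
    have := htrain.length_le
    rwa [List.getD_cons_zero, length_unary] at this
  have hes : ∀ e ∈ List.ofFn fun j => (List.ofFn (xs j), f (xs j)), e.1.length = a 0 := by
    intro e he
    obtain ⟨j, rfl⟩ := (List.mem_ofFn' _ _).1 he
    exact List.length_ofFn
  refine ⟨rep, ?_, fun x => ?_⟩
  · rw [sampleBits_padMap h0 hfg] at htrain
    rw [hp, sampleBits_eq_encode]
    refine ((runs_padTrain ha hK hes coins).outputs htrain).weaken ?_
    rw [List.length_ofFn]
    have := Nat.mul_le_mul_right (14 * a 0 + 9 * K + 13) hm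
    unfold paddedTime
    omega
  · have hx := hpredict (padMap K x)
    rw [hp', List.cons_append, List.cons_append, List.cons_append, List.nil_append,
      ofFn_padMap h0] at hx
    rw [hp]
    refine ((runs_padPredict ha hK List.length_ofFn rep).outputs hx).weaken ?_
    unfold paddedTime
    omega

/-- Images of independent examples from `D` are independent examples from `D.map φ`, with the random
bits untouched. -/
lemma real_prod_le_of_map {α β γ : Type*} [Finite α] [Finite β] [Finite γ]
    [MeasurableSpace α] [MeasurableSpace β] [MeasurableSpace γ]
    [MeasurableSingletonClass α] [MeasurableSingletonClass β] [MeasurableSingletonClass γ]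
    {m : ℕ} (φ : α → β) (D : Measure α) [IsProbabilityMeasure D] (μ : Measure γ)
    [IsProbabilityMeasure μ] {E : Set ((Fin m → α) × γ)} {E' : Set ((Fin m → β) × γ)}
    (h : ∀ ω : (Fin m → α) × γ, (fun j => φ (ω.1 j), ω.2) ∈ E' → ω ∈ E) :
    ((Measure.pi fun _ : Fin m => D.map φ).prod μ).real E' ≤
      ((Measure.pi fun _ : Fin m => D).prod μ).real E := by
  have hφ : Measurable φ := measurable_of_finite φ
  have : IsProbabilityMeasure (D.map φ) := Measure.isProbabilityMeasure_map hφ.aemeasurable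
  have h1 : (Measure.pi fun _ : Fin m => D.map φ) =
      (Measure.pi fun _ : Fin m => D).map fun x j => φ (x j) :=
    (Measure.pi_map_pi fun _ => hφ.aemeasurable).symm
  have h2 : ((Measure.pi fun _ : Fin m => D.map φ).prod μ) =
      ((Measure.pi fun _ : Fin m => D).prod μ).map
        (Prod.map (fun x j => φ (x j)) id) := by
    rw [h1]
    conv_lhs => rw [← Measure.map_id (μ := μ)]
    exact Measure.map_prod_map _ _ (measurable_of_finite _) measurable_id
  rw [h2, map_measureReal_apply (measurable_of_finite _) (Set.toFinite _).measurableSet]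
  exact measureReal_mono fun ω hω => h ω hω

instance (r : ℕ) : IsProbabilityMeasure (coinFlips r) := by
  unfold coinFlips
  infer_instance

open MvPolynomial in
/-- If the functions in `H a` are iterated linear thresholds of padded inputs, learners for iterated
linear thresholds yield learners for `H`. -/
theorem PolyTimeLearnable.of_endToEnd {randomized : Bool} {ε δ : ℝ}
    (hlearn : PolyTimeEndToEndLearnableLin randomized ε δ) (c k : ℕ) (hc : 0 < c)
    (H : (a : Fin 1 → ℕ) → Set ((Fin (a 0) → Bool) → Bool))
    (hH : ∀ a : Fin 1 → ℕ, 0 < a 0 → ∀ f ∈ H a,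
      ∃ g ∈ linClass (a 0 + 1 + 3 * (c * a 0 ^ k)), ∀ x,
        f x = endToEnd g (c * a 0 ^ k) (padded (c * a 0 ^ k) (List.ofFn x))) :
    PolyTimeLearnable randomized H ε δ := by
  obtain ⟨A, time, coins, m, hcoins, hA⟩ := hlearn
  let κ : MvPolynomial (Fin 1) ℕ := C c * X 0 ^ k
  -- The parameters `(n, d, T)` of the padded problem as polynomials in the original `n`;
  -- substituting them with `bind₁` keeps all bounds polynomial.
  let gs : Fin 3 → MvPolynomial (Fin 1) ℕ := ![X 0 + 1 + 2 * κ, X 0 + 1 + 3 * κ, κ]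
  let a' : (Fin 1 → ℕ) → Fin 3 → ℕ := fun a i => eval a (gs i)
  have hbind : ∀ a p, eval a (bind₁ gs p) = eval (a' a) p := fun a p => by
    rw [← aeval_eq_eval, aeval_bind₁]
    rfl
  refine ⟨A.padded c k, paddedTime (c : MvPolynomial (Fin 1) ℕ) k (X 0) κ (bind₁ gs time)
    (bind₁ gs coins), bind₁ gs coins, fun a => m (a' a), ?_, ?_⟩
  · intro h
    rw [hcoins h, map_zero]
  intro a hpos
  have ha := hpos 0
  have hκ : eval a κ = c * a 0 ^ k := by simp [κ]
  have h0 : a' a 0 = a 0 + 1 + 2 * (c * a 0 ^ k) := by simp [a', gs, hκ]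
  have h1 : a' a 1 = a 0 + 1 + 3 * (c * a 0 ^ k) := by simp [a', gs, hκ]
  have h2 : a' a 2 = c * a 0 ^ k := by simp [a', gs, hκ]
  have hK : 0 < c * a 0 ^ k := by positivity
  have htime : eval a (paddedTime (c : MvPolynomial (Fin 1) ℕ) k (X 0) κ (bind₁ gs time)
      (bind₁ gs coins)) = paddedTime c k (a 0) (c * a 0 ^ k) (eval (a' a) time)
        (eval (a' a) coins) := by
    simp only [paddedTime, map_add, map_mul, map_natCast, Nat.cast_id, map_ofNat, map_one,
      hκ, hbind, eval_X]
  rw [htime]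
  obtain ⟨hm, hA⟩ := hA (a' a) (by
    intro i
    fin_cases i
    · exact h0.symm ▸ (by omega)
    · exact h1.symm ▸ (by omega)
    · exact h2.symm ▸ hK)
  refine ⟨hm.trans ?_, fun f hf => ?_⟩
  · unfold paddedTime
    omega
  rw [hbind]
  obtain ⟨g, hg, hfg⟩ := hH a ha f hf
  let g' : (Fin (a' a 0) → Bool) → Bool := fun y => endToEnd g (a' a 2) (List.ofFn y)
  have hfg' : ∀ x, f x = g' (padMap (c * a 0 ^ k) x) := fun x => by
    simp only [g']
    rw [hfg, ofFn_padMap h0, h2]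
  obtain ⟨hret, hprob⟩ := hA g' ⟨g, h1 ▸ hg, fun _ => rfl⟩
  have key : ∀ xs (cs : Fin (eval (a' a) coins) → Bool) h,
      A.Returns (a' a) (eval (a' a) time)
        (sampleBits g' fun j => padMap (c * a 0 ^ k) (xs j)) (List.ofFn cs) h →
      (A.padded c k).Returns a (paddedTime c k (a 0) (c * a 0 ^ k) (eval (a' a) time)
        (eval (a' a) coins)) (sampleBits f (m := m (a' a)) xs) (List.ofFn cs)
          fun x => h (padMap (c * a 0 ^ k) x) := by
    intro xs cs h hr
    have := hr.padded ha rfl h0 h1 h2 hm hfg'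
    rwa [List.length_ofFn] at this
  refine ⟨fun xs cs => ?_, fun D hD => ?_⟩
  · obtain ⟨h, hr⟩ := hret (fun j => padMap (c * a 0 ^ k) (xs j)) cs
    exact ⟨_, key xs cs h hr⟩
  · have hφ : Measurable (padMap (c * a 0 ^ k) : (Fin (a 0) → Bool) → Fin (a' a 0) → Bool) :=
      measurable_of_finite _
    refine (hprob (D.map (padMap (c * a 0 ^ k)))
      (Measure.isProbabilityMeasure_map hφ.aemeasurable)).trans
      (real_prod_le_of_map _ D _ ?_)
    rintro ω ⟨h, hr, hε⟩
    refine ⟨_, key ω.1 ω.2 h hr, ?_⟩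
    -- The preimage under padding of the error set of `h` is the error set of the composed
    -- hypothesis.
    rw [map_measureReal_apply hφ (Set.toFinite _).measurableSet] at hε
    refine le_of_eq_of_le (congrArg D.real ?_) hε
    ext x
    simp only [Set.mem_ofPred_eq, Set.mem_preimage, hfg']

/-- A monomial bound suffices for `K`, and `Prog.monomial` can compute it. -/
lemma Polynomial.eval_le_eval_one_mul_pow (p : Polynomial ℕ) {n : ℕ} (hn : 0 < n) :
    p.eval n ≤ p.eval 1 * n ^ p.natDegree := by
  rw [Polynomial.eval_eq_sum_range, Polynomial.eval_eq_sum_range, Finset.sum_mul]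
  refine Finset.sum_le_sum fun i hi => ?_
  rw [one_pow, mul_one]
  exact Nat.mul_le_mul_left _ (Nat.pow_le_pow_right hn (Finset.mem_range_succ_iff.1 hi))

theorem mainTheorem10 (randomized : Bool) (hard : HardnessOfLearningTC0 randomized) :
    ∀ ε δ : ℝ, 0 < ε → ε < 1 / 2 → 0 < δ → δ < 1 →
      ¬ PolyTimeEndToEndLearnableLin randomized ε δ := by
  intro ε δ hε hε' hδ hδ' hlearn
  obtain ⟨L, p, -, hard⟩ := hard
  refine hard ε δ hε hε' hδ hδ' ?_
  -- `S` bounds the gate ranks, `A` exceeds both `2 * S ^ 2` and `n`, and `Q` is `2 * sidon A S +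
  -- 2`, as `exists_linGen` requires.
  let S : Polynomial ℕ := p * p + p
  let A : Polynomial ℕ := 2 * (S * S) + Polynomial.X + 1
  let Q : Polynomial ℕ := 2 * (A * S + S * S) + 2
  refine PolyTimeLearnable.of_endToEnd hlearn (Q.eval 1) Q.natDegree (by simp [Q]) _
    fun a ha f hf => ?_
  have hQ := Q.eval_le_eval_one_mul_pow ha
  obtain ⟨s, hs, C, -, hfC⟩ := hf
  have hS : s * s + s ≤ S.eval (a 0) := by
    simp only [S, Polynomial.eval_add, Polynomial.eval_mul]
    exact Nat.add_le_add (Nat.mul_le_mul hs hs) hs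
  have hA : A.eval (a 0) = 2 * (S.eval (a 0) * S.eval (a 0)) + a 0 + 1 := by
    simp [A]
  obtain ⟨g, hg, h⟩ := C.exists_linGen (A := A.eval (a 0))
    (K := Q.eval 1 * a 0 ^ Q.natDegree) hS (by omega) (by omega)
    (by
      refine le_of_eq_of_le ?_ hQ
      simp [Q, sidon])
  refine ⟨g, ?_, fun x => (hfC x).trans (h x)⟩
  rwa [show a 0 + 1 + 3 * (Q.eval 1 * a 0 ^ Q.natDegree) =
    3 * (Q.eval 1 * a 0 ^ Q.natDegree) + a 0 + 1 by ring]
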